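/- Let $\Omega$ be a finite nonempty set (the computational basis $\{|z\rangle\}_{z\in\Omega}$), let $G$ be a group of permutations of $\Omega$ whose natural action is regular (transitive, and no non-identity element has a fixed point), and let $P_\sigma$ be the permutation matrix with $P_\sigma|z\rangle=|\sigma(z)\rangle$. Let $H$ be a Hermitian matrix written in permutation matrix representation $H=\sum_{\sigma\in G}D_\sigma P_\sigma$ with diagonal matrices $D_\sigma$; write $D_\sigma(z)=\langle z|D_\sigma|z\rangle$ and $E_z=D_{1}(z)$. Let $\beta\neq 0$ be a real inverse temperature. For an entire function $f$ let $f[x_0,\dots,x_q]=\frac{1}{2\pi i}\oint \frac{f(x)}{\prod_{i=0}^q(x-x_i)}\,dx$ be its divided difference (the positively oriented contour enclosing all $x_i$), and write $e^{-\beta[x_0,\dots,x_q]}$ for the divided difference of $x\mapsto e^{-\beta x}$. A configuration $\mathcal C=(z,(i_1,\dots,i_q))$ consists of $z\in\Omega$, $q\ge 0$ and non-identity elements $i_1,\dots,i_q\in G$ with $P_{i_q}\cdots P_{i_1}=\mathbb 1$. Put $|z_0\rangle=|z\rangle$, $|z_k\rangle=P_{i_k}\cdots P_{i_1}|z\rangle$,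 $D_{\mathcal C}=\prod_{k=1}^q D_{i_k}(z_k)$ and $w_{\mathcal C}=D_{\mathcal C}\,e^{-\beta[E_{z_0},\dots,E_{z_q}]}$. (i) For every entire $f$, with $f(H)=\sum_{n\ge0}\frac{f^{(n)}(0)}{n!}H^n$ (a convergent series), $$\operatorname{Tr} f(H)=\sum_{\mathcal C}D_{\mathcal C}\,f[E_{z_0},\dots,E_{z_q}],$$ the sum over all configurations being absolutely convergent. (ii) $e^{-\beta[E_{z_0},\dots,E_{z_q}]}\neq0$ for every configuration. (iii) Let $L\ge0$, let $\Lambda_1,\dots,\Lambda_{L+1}$ be arbitrary diagonal matrices, let $l_1,\dots,l_L$ be non-identity elements of $G$, and let $$A=\Lambda_1D_{l_1}P_{l_1}\,\Lambda_2D_{l_2}P_{l_2}\cdots\Lambda_LD_{l_L}P_{l_L}\,\Lambda_{L+1}.$$ For a configuration with $q\ge L$ define $$A_{\mathcal C}=\mathcal A(\mathcal C)\,\frac{e^{-\beta[E_{z_0},\dots,E_{z_{q-L}}]}}{e^{-\beta[E_{z_0},\dots,E_{z_q}]}},\qquad \mathcal A(\mathcal C)=\Lambda_{L+1}(z_{q-L})\prod_{s=1}^L\Lambda_s(z_{q-s+1})\,\delta^{(q-s+1)}_{P_{l_s}},$$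 where $\delta^{(k)}_{P}=1$ if $P_{i_k}=P$ and $0$ otherwise, and put $A_{\mathcal C}=0$ if $q<L$. Then $A_{\mathcal C}$ is an unbiased estimator of $A$: $\operatorname{Tr}[e^{-\beta H}]\ne0$, the series $\sum_{\mathcal C}w_{\mathcal C}$ and $\sum_{\mathcal C}w_{\mathcal C}A_{\mathcal C}$ converge absolutely, $\sum_{\mathcal C}w_{\mathcal C}\neq0$, and $$\frac{\operatorname{Tr}[A\,e^{-\beta H}]}{\operatorname{Tr}[e^{-\beta H}]}=\frac{\sum_{\mathcal C}w_{\mathcal C}A_{\mathcal C}}{\sum_{\mathcal C}w_{\mathcal C}}.$$ -/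

import Mathlib

namespace PMR

noncomputable section

variable {Ω : Type*} [Fintype Ω] [DecidableEq Ω]

/-- The natural action of the permutation group `G` on `Ω` is regular: it is transitive, and no
non-identity element of `G` fixes a point. -/
def IsRegularGroup (G : Subgroup (Equiv.Perm Ω)) : Prop :=
  (∀ x y : Ω, ∃ σ ∈ G, σ x = y) ∧ ∀ σ ∈ G, ∀ x : Ω, σ x = x → σ = 1

/-- The permutation matrix `P_σ` in the column convention `P_σ |x⟩ = |σ x⟩`. -/
def permMat (σ : Equiv.Perm Ω) : Matrix Ω Ω ℂ := (σ⁻¹).permMatrix ℂ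

theorem permMat_apply (σ : Equiv.Perm Ω) (y x : Ω) :
    permMat σ y x = if y = σ x then 1 else 0 := by
  have h : x = (Equiv.symm σ) y ↔ y = σ x := by rw [Equiv.eq_symm_apply, eq_comm]
  simp [permMat, PEquiv.toMatrix_apply, Equiv.Perm.inv_def, eq_comm, h]

theorem permMat_mulVec_single (σ : Equiv.Perm Ω) (x : Ω) :
    (permMat σ).mulVec (Pi.single x 1) = Pi.single (σ x) 1 := by
  ext y
  simp [permMat_apply, Pi.single_apply]

/-- The matrix `∑_{σ ∈ G} D_σ P_σ`; the diagonal matrix `D_σ` is given by its diagonal. -/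
def pmrMatrix (G : Subgroup (Equiv.Perm Ω)) [Fintype G] (D : G → Ω → ℂ) : Matrix Ω Ω ℂ :=
  ∑ σ : G, Matrix.diagonal (D σ) * permMat (σ : Equiv.Perm Ω)

/-- The non-identity elements of `G`, labelling the off-diagonal terms `D_σ P_σ`. -/
abbrev OffDiag (G : Subgroup (Equiv.Perm Ω)) : Type _ := {σ : G // σ ≠ 1}

/-- The product `P_{i_q} ⋯ P_{i_1}` of a word `[i_1, …, i_q]`. -/
def wordProd {G : Subgroup (Equiv.Perm Ω)} (w : List (OffDiag G)) : G :=
  (w.reverse.map Subtype.val).prod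

/-- A configuration `(z, S)`: a basis state `z` and a word `[i_1, …, i_q]` of off-diagonal
permutations whose product `S = P_{i_q} ⋯ P_{i_1}` is the identity. -/
structure Config (G : Subgroup (Equiv.Perm Ω)) where
  z : Ω
  word : List (OffDiag G)
  closed : wordProd word = 1

namespace Config

variable {G : Subgroup (Equiv.Perm Ω)}

/-- The expansion order `q`. -/
def q (C : Config G) : ℕ := C.word.length

/-- The state `z_k = P_{i_k} ⋯ P_{i_1} z`, for `0 ≤ k ≤ q`. -/
def state (C : Config G) (k : ℕ) : Ω := (wordProd (C.word.take k) : Equiv.Perm Ω) C.z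

/-- The diagonal energy `E_{z_k} = ⟨z_k| D_1 |z_k⟩`, with `D_1` the diagonal part of the
Hamiltonian. -/
def energy (D : G → Ω → ℂ) (C : Config G) (k : ℕ) : ℂ := D 1 (C.state k)

/-- The hopping strength `∏_{k=1}^q ⟨z_k| D_{i_k} |z_k⟩`. -/
def hopping (D : G → Ω → ℂ) (C : Config G) : ℂ :=
  ∏ k : Fin C.word.length, D (C.word.get k).1 (C.state (k + 1))

/-- `δ^{(k)}_{P_σ}`, for `1 ≤ k ≤ q`: is the `k`-th permutation `i_k` of the word equal to `σ`? -/
def delta (C : Config G) (k : ℕ) (σ : OffDiag G) : ℂ :=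
  if C.word[k - 1]? = some σ then 1 else 0

end Config

/-- The divided difference `f[x_0, …, x_q] = (2πi)⁻¹ ∮ f(w) / ∏_{i=0}^q (w - x_i) dw` of an entire
function `f`, over a positively oriented circle enclosing all of `x_0, …, x_q`. -/
def divDiff (f : ℂ → ℂ) (x : ℕ → ℂ) (q : ℕ) : ℂ :=
  (2 * Real.pi * Complex.I)⁻¹ *
    ∮ w in C(0, 1 + ∑ i ∈ Finset.range (q + 1), ‖x i‖),
      f w / ∏ i ∈ Finset.range (q + 1), (w - x i)

/-- The divided difference of the exponential, `e^{t[x_0, …, x_q]}`. -/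
def dde (t : ℝ) (x : ℕ → ℂ) (q : ℕ) : ℂ := divDiff (fun w => Complex.exp (t * w)) x q

/-- The generalized Boltzmann weight `w_C = D_{(z,S)} e^{-β[E_{z_0}, …, E_{z_q}]}`. -/
def weight {G : Subgroup (Equiv.Perm Ω)} (D : G → Ω → ℂ) (β : ℝ) (C : Config G) : ℂ :=
  C.hopping D * dde (-β) (C.energy D) C.q

/-- The unnormalized thermal state `e^{-βH}`. -/
def gibbs (H : Matrix Ω Ω ℂ) (β : ℝ) : Matrix Ω Ω ℂ := NormedSpace.exp ((-(β : ℂ)) • H)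

/-- `est` is an unbiased estimator of `A` for `H = ∑_σ D_σ P_σ` at inverse temperature `β`:
`Tr[A e^{-βH}] / Tr[e^{-βH}] = (∑_C w_C est(C)) / (∑_C w_C)`, where both series over all
configurations converge absolutely and both denominators are nonzero. -/
def IsUnbiasedEstimator (G : Subgroup (Equiv.Perm Ω)) [Fintype G] (D : G → Ω → ℂ) (β : ℝ)
    (A : Matrix Ω Ω ℂ) (est : Config G → ℂ) : Prop :=
  (gibbs (pmrMatrix G D) β).trace ≠ 0 ∧
  Summable (weight D β) ∧ (∑' C : Config G, weight D β C) ≠ 0 ∧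
  Summable (fun C : Config G => weight D β C * est C) ∧
  (A * gibbs (pmrMatrix G D) β).trace / (gibbs (pmrMatrix G D) β).trace =
    (∑' C : Config G, weight D β C * est C) / ∑' C : Config G, weight D β C

/-- The canonical product `Λ_1 D_{l_1} P_{l_1} ⋯ Λ_L D_{l_L} P_{l_L} Λ_{L+1}`. Indices start at `0`
here: `Λ s` and `l s` stand for `Λ_{s+1}` and `l_{s+1}`. -/
def canonicalProduct {G : Subgroup (Equiv.Perm Ω)} (D : G → Ω → ℂ) {L : ℕ}
    (Λ : Fin (L + 1) → Ω → ℂ) (l : Fin L → OffDiag G) : Matrix Ω Ω ℂ :=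
  (List.ofFn fun s : Fin L =>
    Matrix.diagonal (Λ s.castSucc) * Matrix.diagonal (D (l s).1) *
      permMat ((l s).1 : Equiv.Perm Ω)).prod * Matrix.diagonal (Λ (Fin.last L))

/-- `𝒜(C) = Λ_{L+1}(z_{q-L}) ∏_{s=1}^L Λ_s(z_{q-s+1}) δ^{(q-s+1)}_{P_{l_s}}` for `L ≤ q`; with the
index `s` starting at `0`, the position `q-s+1` is written `q - s`. -/
def canonicalPrefactor {G : Subgroup (Equiv.Perm Ω)} {L : ℕ}
    (Λ : Fin (L + 1) → Ω → ℂ) (l : Fin L → OffDiag G) (C : Config G) : ℂ :=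
  Λ (Fin.last L) (C.state (C.q - L)) *
    ∏ s : Fin L, Λ s.castSucc (C.state (C.q - s)) * C.delta (C.q - s) (l s)

/-- The canonical estimator
`𝒜(C) e^{-β[E_{z_0}, …, E_{z_{q-L}}]} / e^{-β[E_{z_0}, …, E_{z_q}]}`, which is `0` if `q < L` (the
word is then too short for the `L` delta conditions). -/
def canonicalEstimator {G : Subgroup (Equiv.Perm Ω)} (D : G → Ω → ℂ) (β : ℝ) {L : ℕ}
    (Λ : Fin (L + 1) → Ω → ℂ) (l : Fin L → OffDiag G) (C : Config G) : ℂ :=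
  if L ≤ C.q then
    canonicalPrefactor Λ l C * (dde (-β) (C.energy D) (C.q - L) / dde (-β) (C.energy D) C.q)
  else 0

/-- The `n`-th term `(f^{(n)}(0) / n!) Hⁿ` of the Taylor series defining `f(H)`. -/
def taylorTerm (f : ℂ → ℂ) (H : Matrix Ω Ω ℂ) (n : ℕ) : Matrix Ω Ω ℂ :=
  (iteratedDeriv n f 0 / (n.factorial : ℂ)) • H ^ n

end

end PMR

/-!
Both sides of the trace formula are expansions of `(2πi)⁻¹ ∮ f(s) (s - H)⁻¹ ds` over one large circle
about the origin.

On the one hand, the Laurent series of the resolvent at infinity (`laurent_mul`) and Cauchy's formula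
for the derivatives at `0` turn the integral into the Taylor series of `f(H)`. On the other hand, the
resolvent is a sum over all words `[i_1, …, i_q]` of off-diagonal permutations: its `(y, x)` element
collects `∏ D_{i_k}(z_k) / ∏ (s - E_{z_k})` over the words whose path leads from `x` to `y`. Splitting
off the first letter of a word shows that this sum is a left inverse of `s - H` (`resolvent_mul`).
The integral of `f(s) / ∏ (s - E_{z_k})` is a divided difference, so that the matrix elements of
`f(H)` are sums over paths (`exists_hasSum_taylorTerm_and_words`). On a large circle the series over
words is dominated by a geometric one, which gives absolute convergence and allows termwise
integration.

A canonical product `A` moves a basis state along the path of its own word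
(`canonicalProduct_apply`). Hence `Tr[A f(H)]` is a sum over the paths that the word of `A` closes
up; regularity of the action says that these closed paths are exactly the configurations whose word
ends with the word of `A`, and those are the configurations that the delta factors select
(`hasSum_config_trace`). The empty product gives `Tr f(H)`, and `f(s) = e^{-βs}` gives numerator and
denominator of the estimator.

The estimator's denominators do not vanish because the energies, being diagonal elements of a
Hermitian matrix, are real: expanding `e^{ts}` in powers of `t (s - c)`, with `c` the energy that
minimizes `t E`, the divided differences of order `q` of the powers are real, none has the sign
opposite to `t ^ q`, and that of the `q`-th power is nonzero (`divDiff_pow_sign`, `dde_ne_zero`). Finally `Tr e^{-βH} ≠ 0` because `e^{-βH} = XᴴX` with `X`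
invertible.
-/

namespace PMR

/-! ### Divided differences of entire functions -/

/-- Termwise integration over a circle of a series dominated by a summable sequence. -/
theorem hasSum_circleIntegral {ι : Type*} [Countable ι] {c : ℂ} {R : ℝ} (hR : 0 ≤ R)
    {F : ι → ℂ → ℂ} {g : ℂ → ℂ} {u : ι → ℝ} (hu : Summable u)
    (hF : ∀ i, ContinuousOn (F i) (Metric.sphere c R))
    (hb : ∀ i, ∀ w ∈ Metric.sphere c R, ‖F i w‖ ≤ u i)
    (hs : ∀ w ∈ Metric.sphere c R, HasSum (fun i => F i w) (g w)) :
    HasSum (fun i => ∮ w in C(c, R), F i w) (∮ w in C(c, R), g w) := by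
  have hmem : ∀ θ, circleMap c R θ ∈ Metric.sphere c R := fun θ => circleMap_mem_sphere c hR θ
  refine intervalIntegral.hasSum_integral_of_dominated_convergence (fun i _ => R * u i)
    (fun i => ?_) (fun i => ?_) ?_ ?_ ?_
  · have hc : Continuous fun θ : ℝ => deriv (circleMap c R) θ • F i (circleMap c R θ) := by
      simp only [deriv_circleMap]
      exact ((continuous_circleMap 0 R).mul continuous_const).smul
        ((hF i).comp_continuous (continuous_circleMap c R) hmem)
    exact hc.aestronglyMeasurable
  · refine Filter.Eventually.of_forall fun θ _ => ?_
    simp only [deriv_circleMap, smul_eq_mul, norm_mul, norm_circleMap_zero, Complex.norm_I,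
      mul_one, abs_of_nonneg hR]
    exact mul_le_mul_of_nonneg_left (hb i _ (hmem θ)) hR
  · exact Filter.Eventually.of_forall fun θ _ => hu.mul_left R
  · simp
  · exact Filter.Eventually.of_forall fun θ _ => (hs _ (hmem θ)).const_smul _

theorem prod_sub_ne_zero {x : ℕ → ℂ} {q : ℕ} {B : ℝ} (hB : ∀ i ≤ q, ‖x i‖ < B) {w : ℂ}
    (hw : B ≤ ‖w‖) : ∏ i ∈ Finset.range (q + 1), (w - x i) ≠ 0 := by
  refine Finset.prod_ne_zero_iff.2 fun i hi h => ?_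
  have := hB i (Nat.lt_succ_iff.1 (Finset.mem_range.1 hi))
  rw [sub_eq_zero.1 h] at hw
  linarith

theorem continuousOn_div_prod {f : ℂ → ℂ} (hf : Continuous f) {x : ℕ → ℂ} {q : ℕ} {R : ℝ}
    (hR : ∀ i ≤ q, ‖x i‖ < R) :
    ContinuousOn (fun w => f w / ∏ i ∈ Finset.range (q + 1), (w - x i))
      (Metric.sphere 0 R) := by
  refine hf.continuousOn.div (by fun_prop) fun w hw => prod_sub_ne_zero hR ?_
  simp at hw
  exact hw.ge

theorem circleIntegral_div_prod_eq {f : ℂ → ℂ} (hf : Differentiable ℂ f) {x : ℕ → ℂ} {q : ℕ}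
    {r R : ℝ} (hr : ∀ i ≤ q, ‖x i‖ < r) (hrR : r ≤ R) :
    (∮ w in C(0, R), f w / ∏ i ∈ Finset.range (q + 1), (w - x i)) =
      ∮ w in C(0, r), f w / ∏ i ∈ Finset.range (q + 1), (w - x i) := by
  have h0 : 0 < r := (norm_nonneg _).trans_lt (hr 0 (Nat.zero_le _))
  refine Complex.circleIntegral_eq_of_differentiable_on_annulus_off_countable h0 hrR
    Set.countable_empty ?_ ?_
  · refine hf.continuous.continuousOn.div (by fun_prop) fun w hw => prod_sub_ne_zero hr ?_
    simpa using hw.2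
  · intro w hw
    refine (hf w).div (by fun_prop) (prod_sub_ne_zero hr ?_)
    have := hw.1.2
    simp at this
    exact this.le

theorem norm_lt_defaultRadius (x : ℕ → ℂ) (q : ℕ) :
    ∀ i ≤ q, ‖x i‖ < 1 + ∑ i ∈ Finset.range (q + 1), ‖x i‖ := by
  intro i hi
  have := Finset.single_le_sum (f := fun i => ‖x i‖) (fun j _ => norm_nonneg _)
    (Finset.mem_range.2 (Nat.lt_succ_iff.2 hi))
  linarith

/-- The divided difference of an entire function may be computed on any circle about the origin
that encloses the nodes. -/
theorem divDiff_eq {f : ℂ → ℂ} (hf : Differentiable ℂ f) {x : ℕ → ℂ} {q : ℕ} {R : ℝ}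
    (hR : ∀ i ≤ q, ‖x i‖ < R) :
    divDiff f x q = (2 * Real.pi * Complex.I)⁻¹ *
      ∮ w in C(0, R), f w / ∏ i ∈ Finset.range (q + 1), (w - x i) := by
  rw [divDiff]
  congr 1
  rcases le_total R (1 + ∑ i ∈ Finset.range (q + 1), ‖x i‖) with h | h
  · exact circleIntegral_div_prod_eq hf hR h
  · exact (circleIntegral_div_prod_eq hf (norm_lt_defaultRadius x q) h).symm

theorem divDiff_add {f g : ℂ → ℂ} (hf : Continuous f) (hg : Continuous g) (x : ℕ → ℂ) (q : ℕ) :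
    divDiff (fun w => f w + g w) x q = divDiff f x q + divDiff g x q := by
  have hx := norm_lt_defaultRadius x q
  have h0 : (0 : ℝ) ≤ 1 + ∑ i ∈ Finset.range (q + 1), ‖x i‖ := by positivity
  simp only [divDiff, add_div]
  rw [circleIntegral.integral_add
    ((continuousOn_div_prod hf hx).circleIntegrable h0)
    ((continuousOn_div_prod hg hx).circleIntegrable h0), mul_add]

theorem divDiff_const_mul (a : ℂ) (f : ℂ → ℂ) (x : ℕ → ℂ) (q : ℕ) :
    divDiff (fun w => a * f w) x q = a * divDiff f x q := by
  simp only [divDiff, mul_div_assoc]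
  rw [circleIntegral.integral_const_mul]
  ring

/-- A factor vanishing at the last node lowers the order of the divided difference. -/
theorem divDiff_sub_mul_succ {f : ℂ → ℂ} (hf : Differentiable ℂ f) (x : ℕ → ℂ) (q : ℕ) :
    divDiff (fun w => (w - x (q + 1)) * f w) x (q + 1) = divDiff f x q := by
  have hx := norm_lt_defaultRadius x (q + 1)
  rw [divDiff_eq hf (fun i hi => hx i (hi.trans (Nat.le_succ q))), divDiff]
  congr 1
  refine circleIntegral.integral_congr (by positivity) fun w hw => ?_
  have hw' : w - x (q + 1) ≠ 0 := by
    intro h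
    have h1 := hx (q + 1) le_rfl
    rw [← sub_eq_zero.1 h] at h1
    rw [mem_sphere_zero_iff_norm] at hw
    linarith
  rw [Finset.prod_range_succ _ (q + 1), mul_comm (w - x (q + 1)), mul_div_mul_right _ _ hw']

theorem divDiff_zero {f : ℂ → ℂ} (hf : Differentiable ℂ f) (x : ℕ → ℂ) :
    divDiff f x 0 = f (x 0) := by
  have hx := norm_lt_defaultRadius x 0 0 le_rfl
  have h := Complex.circleIntegral_div_sub_of_differentiable_on_off_countable
    (s := ∅) Set.countable_empty (mem_ball_zero_iff.2 hx) hf.continuous.continuousOn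
    (fun z _ => hf z)
  simp only [divDiff, zero_add, Finset.range_one, Finset.prod_singleton] at h ⊢
  rw [h, inv_mul_cancel_left₀ Complex.two_pi_I_ne_zero]

/-- The divided differences of order at least `1` of a constant vanish: on a circle of radius `R`
the integrand is `O(R⁻²)`. -/
theorem divDiff_one_succ (x : ℕ → ℂ) (q : ℕ) : divDiff (fun _ => 1) x (q + 1) = 0 := by
  set B : ℝ := 1 + ∑ i ∈ Finset.range (q + 1 + 1), ‖x i‖
  have hB := norm_lt_defaultRadius x (q + 1)
  have hB0 : 0 ≤ B := by positivity
  have key : ∀ s : ℝ, 1 ≤ s → ‖divDiff (fun _ => 1) x (q + 1)‖ * s ≤ B + 1 := by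
    intro s hs
    have hs0 : 0 < s := by linarith
    rw [divDiff_eq (differentiable_const _) (R := B + s) (fun i hi => (hB i hi).trans_le
      (by linarith))]
    have h := circleIntegral.norm_two_pi_i_inv_smul_integral_le_of_norm_le_const
      (f := fun w => 1 / ∏ i ∈ Finset.range (q + 1 + 1), (w - x i)) (c := 0) (R := B + s)
      (C := (s ^ 2)⁻¹) (by positivity) (fun w hw => ?_)
    · rw [smul_eq_mul] at h
      calc _ ≤ (B + s) * (s ^ 2)⁻¹ * s := mul_le_mul_of_nonneg_right h hs0.le
        _ = B / s + 1 := by field_simp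
        _ ≤ B + 1 := by gcongr; exact div_le_self hB0 hs
    · rw [norm_div, norm_one, one_div, norm_prod]
      refine inv_anti₀ (by positivity) ?_
      calc s ^ 2 ≤ s ^ (q + 1 + 1) := pow_le_pow_right₀ hs (by omega)
        _ = ∏ i ∈ Finset.range (q + 1 + 1), s := by simp
        _ ≤ _ := by
          refine Finset.prod_le_prod (fun _ _ => hs0.le) fun i hi => ?_
          rw [mem_sphere_zero_iff_norm] at hw
          have h1 := norm_sub_norm_le w (x i)
          have h2 := hB i (Nat.lt_succ_iff.1 (Finset.mem_range.1 hi))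
          linarith
  by_contra hne
  have hpos := norm_pos_iff.2 hne
  have := key ((B + 1) / ‖divDiff (fun _ => 1) x (q + 1)‖ + 1)
    (le_add_of_nonneg_left (by positivity))
  rw [mul_add, mul_div_cancel₀ _ hpos.ne', mul_one] at this
  linarith

/-- The divided differences of the powers of `t (w - c)` at real nodes `x_k` with
`t (x_k - c) ≥ 0` are real and, unless zero, of the sign of `t ^ q`. -/
theorem divDiff_pow_sign (t c : ℝ) (x : ℕ → ℝ) (hc : ∀ k, 0 ≤ t * (x k - c)) (ht : t ≠ 0)
    (n : ℕ) : ∀ q : ℕ, ∃ K : ℝ,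
      divDiff (fun w => ((t : ℂ) * (w - c)) ^ n) (fun k => (x k : ℂ)) q = K ∧
      0 ≤ t ^ q * K ∧ (n = q → 0 < t ^ q * K) := by
  induction n with
  | zero =>
    rintro (_ | q)
    · refine ⟨1, ?_, by simp, by simp⟩
      rw [divDiff_zero (by fun_prop)]
      simp
    · refine ⟨0, ?_, by simp, by simp⟩
      simpa using divDiff_one_succ _ _
  | succ n ih =>
    rintro (_ | q)
    · refine ⟨(t * (x 0 - c)) ^ (n + 1), ?_, ?_, by simp⟩
      · rw [divDiff_zero (by fun_prop)]
        push_cast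
        rfl
      · have := pow_nonneg (hc 0) (n + 1)
        simpa using this
    · obtain ⟨K, hK, hK0, hK1⟩ := ih q
      obtain ⟨K', hK', hK0', -⟩ := ih (q + 1)
      have ht2 : 0 < t ^ 2 := by positivity
      -- Writing `w - c = (w - x_{q+1}) + (x_{q+1} - c)` gives a recursion with nonnegative weights.
      have hsplit : t ^ (q + 1) * (t * K + t * (x (q + 1) - c) * K') =
          t ^ 2 * (t ^ q * K) + t * (x (q + 1) - c) * (t ^ (q + 1) * K') := by ring
      have h1 := mul_nonneg (hc (q + 1)) hK0'
      refine ⟨t * K + t * (x (q + 1) - c) * K', ?_, ?_, fun h => ?_⟩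
      · have hfun : (fun w : ℂ => ((t : ℂ) * (w - c)) ^ (n + 1)) = fun w : ℂ =>
            (t : ℂ) * ((w - (x (q + 1) : ℂ)) * ((t : ℂ) * (w - c)) ^ n) +
              ((t : ℂ) * (x (q + 1) - c)) * ((t : ℂ) * (w - c)) ^ n := by
          funext w; ring
        rw [hfun, divDiff_add (by fun_prop) (by fun_prop), divDiff_const_mul, divDiff_const_mul,
          divDiff_sub_mul_succ (x := fun k => (x k : ℂ)) (by fun_prop), hK, hK']
        push_cast
        ring
      · rw [hsplit]
        have := mul_nonneg ht2.le hK0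
        linarith
      · rw [hsplit]
        have := mul_pos ht2 (hK1 (by omega))
        linarith

/-- Divided differences of the exponential at real nodes do not vanish. The exponential is expanded
about a point `c` on the side of the nodes for which all terms have the sign of `t ^ q`. -/
theorem dde_ne_zero {t c : ℝ} (ht : t ≠ 0) {x : ℕ → ℝ} (hc : ∀ k, 0 ≤ t * (x k - c)) (q : ℕ) :
    dde t (fun k => (x k : ℂ)) q ≠ 0 := by
  choose K hK hK0 hK1 using fun n => divDiff_pow_sign t c x hc ht n q
  set y : ℕ → ℂ := fun k => (x k : ℂ)
  set R : ℝ := 1 + ∑ i ∈ Finset.range (q + 1), ‖y i‖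
  have hR : 0 ≤ R := by positivity
  have hy := norm_lt_defaultRadius y q
  obtain ⟨M, hM⟩ : ∃ M, ∀ w ∈ Metric.sphere (0 : ℂ) R,
      ‖1 / ∏ i ∈ Finset.range (q + 1), (w - y i)‖ ≤ M :=
    (isCompact_sphere 0 R).exists_bound_of_continuousOn
      (continuousOn_div_prod (f := fun _ => 1) continuous_const hy)
  have hM0 : 0 ≤ M := by
    refine (norm_nonneg _).trans (hM (R : ℂ) ?_)
    simp [abs_of_nonneg hR]
  have hsum : HasSum (fun n : ℕ => ((K n * (Real.exp (t * c) / n.factorial) : ℝ) : ℂ))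
      (dde t y q) := by
    have h := hasSum_circleIntegral (c := 0) hR
      (F := fun (n : ℕ) w => (Complex.exp (t * c) / n.factorial) *
        (((t : ℂ) * (w - c)) ^ n / ∏ i ∈ Finset.range (q + 1), (w - y i)))
      (g := fun w => Complex.exp (t * w) / ∏ i ∈ Finset.range (q + 1), (w - y i))
      (u := fun n : ℕ => ‖Complex.exp (t * c)‖ * M * ((|t| * (R + |c|)) ^ n / n.factorial))
      ((Real.summable_pow_div_factorial _).mul_left _) (fun n => ?_) (fun n w hw => ?_)
      (fun w hw => ?_)
    · have h2 := h.mul_left (2 * Real.pi * Complex.I)⁻¹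
      refine h2.congr_fun ?_
      intro n
      rw [circleIntegral.integral_const_mul]
      have := hK n
      rw [divDiff] at this
      push_cast
      rw [← this]
      ring
    · exact continuousOn_const.mul (continuousOn_div_prod (by fun_prop) hy)
    · have h1 := hM w hw
      rw [mem_sphere_zero_iff_norm] at hw
      have h2 : ‖(t : ℂ) * (w - c)‖ ≤ |t| * (R + |c|) := by
        rw [norm_mul, Complex.norm_real, Real.norm_eq_abs]
        gcongr
        refine (norm_sub_le _ _).trans ?_
        rw [hw, Complex.norm_real, Real.norm_eq_abs]
      rw [div_eq_mul_one_div (_ ^ n), norm_mul, norm_mul, norm_pow, norm_div, Complex.norm_natCast]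
      calc _ ≤ ‖Complex.exp (t * c)‖ / n.factorial * ((|t| * (R + |c|)) ^ n * M) := by
            gcongr
        _ = _ := by ring
    · have h3 : HasSum (fun n : ℕ => ((t : ℂ) * (w - c)) ^ n / n.factorial)
          (Complex.exp (t * (w - c))) := by
        rw [Complex.exp_eq_exp_ℂ]
        exact NormedSpace.expSeries_div_hasSum_exp _
      have h4 := (h3.mul_left (Complex.exp (t * c))).div_const
        (∏ i ∈ Finset.range (q + 1), (w - y i))
      rw [← Complex.exp_add, ← mul_add, add_sub_cancel] at h4
      refine h4.congr_fun fun n => ?_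
      ring
  have hre : HasSum (fun n : ℕ => t ^ q * (K n * (Real.exp (t * c) / n.factorial)))
      (t ^ q * (dde t y q).re) := by
    have := (Complex.hasSum_re hsum).mul_left (t ^ q)
    simpa only [Complex.ofReal_re] using this
  have hnn : ∀ n : ℕ, 0 ≤ t ^ q * (K n * (Real.exp (t * c) / n.factorial)) := fun n => by
    rw [← mul_assoc]
    exact mul_nonneg (hK0 n) (by positivity)
  -- The term of degree `q` is the first nonzero one, so the sum is at least this positive number.
  have hle := le_hasSum hre q fun j _ => hnn j
  have hpos : 0 < t ^ q * (K q * (Real.exp (t * c) / q.factorial)) := by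
    rw [← mul_assoc]
    exact mul_pos (hK1 q rfl) (by positivity)
  intro h0
  rw [h0] at hle
  simp at hle
  linarith

/-! ### Series indexed by words -/

theorem hasSum_list_of_cons {α : Type*} {f : List α → ℂ} {a : ℂ}
    (h : HasSum (fun p : α × List α => f (p.1 :: p.2)) a) : HasSum f (f [] + a) := by
  classical
  have hinj : Function.Injective fun p : α × List α => p.1 :: p.2 := by
    rintro ⟨i, v⟩ ⟨j, w⟩ h
    simpa using h
  have h1 : HasSum (fun w : List α => if w = [] then 0 else f w) a := by
    refine (hinj.hasSum_iff ?_).1 (by simpa [Function.comp_def] using h)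
    rintro (_ | ⟨i, w⟩) hw
    · simp
    · exact absurd ⟨(i, w), rfl⟩ hw
  refine ((hasSum_ite_eq ([] : List α) (f [])).add h1).congr_fun fun w => ?_
  by_cases hw : w = [] <;> simp [hw]

theorem hasSum_prod_of_fintype {α β : Type*} [Fintype α] {f : α × β → ℂ} {g : α → ℂ}
    (h : ∀ i, HasSum (fun b => f (i, b)) (g i)) : HasSum f (∑ i, g i) := by
  classical
  have h1 : ∀ i, HasSum (fun p : α × β => if p.1 = i then f p else 0) (g i) := fun i => by
    have hinj : Function.Injective fun b : β => (i, b) := fun b c h => by simpa using h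
    refine (hinj.hasSum_iff ?_).1 (by simpa [Function.comp_def] using h i)
    rintro ⟨j, b⟩ hp
    refine if_neg fun hj => hp ⟨b, ?_⟩
    simp only at hj
    rw [hj]
  refine (hasSum_sum fun i (_ : i ∈ Finset.univ) => h1 i).congr_fun fun p => ?_
  simp

theorem summable_pow_length {α : Type*} [Fintype α] {r : ℝ} (hr : 0 ≤ r)
    (h : Fintype.card α * r < 1) : Summable fun w : List α => r ^ w.length := by
  rw [← List.equivSigmaTuple.symm.summable_iff]
  refine (summable_sigma_of_nonneg fun _ => pow_nonneg hr _).2 ⟨fun n => (hasSum_fintype _).summable, ?_⟩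
  refine (summable_geometric_of_lt_one (by positivity) h).congr fun n => ?_
  simp [List.equivSigmaTuple, mul_pow]

/-! ### Paths of basis states -/

section Words

variable {Ω : Type*} {G : Subgroup (Equiv.Perm Ω)}

theorem wordProd_nil : wordProd ([] : List (OffDiag G)) = 1 := rfl

theorem wordProd_append (v w : List (OffDiag G)) :
    wordProd (v ++ w) = wordProd w * wordProd v := by
  simp [wordProd]

theorem wordProd_cons (i : OffDiag G) (w : List (OffDiag G)) :
    wordProd (i :: w) = wordProd w * i.1 := by
  simp [wordProd]

/-- The `k`-th state of the path that starts at `z` and follows the letters of the word `w`, which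
need not return to `z`. -/
def wordState (w : List (OffDiag G)) (z : Ω) (k : ℕ) : Ω :=
  (wordProd (w.take k) : Equiv.Perm Ω) z

/-- The product of the off-diagonal matrix elements along the path of the word `w` from `z`. -/
noncomputable def wordHopping (D : G → Ω → ℂ) (w : List (OffDiag G)) (z : Ω) : ℂ :=
  ∏ k : Fin w.length, D (w.get k).1 (wordState w z (k + 1))

theorem wordState_zero (w : List (OffDiag G)) (z : Ω) : wordState w z 0 = z := rfl

theorem wordState_cons_succ (i : OffDiag G) (w : List (OffDiag G)) (z : Ω) (k : ℕ) :
    wordState (i :: w) z (k + 1) = wordState w ((i.1 : Equiv.Perm Ω) z) k := by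
  simp [wordState, wordProd_cons]

theorem wordState_append_of_le (v w : List (OffDiag G)) (z : Ω) {k : ℕ} (hk : k ≤ v.length) :
    wordState (v ++ w) z k = wordState v z k := by
  simp [wordState, List.take_append_of_le_length hk]

theorem wordState_length (w : List (OffDiag G)) (z : Ω) :
    wordState w z w.length = (wordProd w : Equiv.Perm Ω) z := by
  simp [wordState]

theorem wordState_append_length_add (v w : List (OffDiag G)) (z : Ω) (k : ℕ) :
    wordState (v ++ w) z (v.length + k) = wordState w ((wordProd v : Equiv.Perm Ω) z) k := by
  simp [wordState, List.take_append, List.take_of_length_le, wordProd_append]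

theorem wordHopping_nil (D : G → Ω → ℂ) (z : Ω) : wordHopping D [] z = 1 := by
  simp [wordHopping]

theorem wordHopping_cons (D : G → Ω → ℂ) (i : OffDiag G) (w : List (OffDiag G)) (z : Ω) :
    wordHopping D (i :: w) z =
      D i.1 ((i.1 : Equiv.Perm Ω) z) * wordHopping D w ((i.1 : Equiv.Perm Ω) z) := by
  have h := Fin.prod_univ_succ (fun k : Fin (w.length + 1) =>
    D ((i :: w).get k).1 (wordState (i :: w) z (k + 1)))
  refine h.trans ?_
  simp only [Fin.val_succ, wordState_cons_succ]
  rfl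

theorem wordHopping_append (D : G → Ω → ℂ) (v w : List (OffDiag G)) (z : Ω) :
    wordHopping D (v ++ w) z =
      wordHopping D v z * wordHopping D w ((wordProd v : Equiv.Perm Ω) z) := by
  induction v generalizing z with
  | nil => simp [wordHopping_nil, wordProd_nil]
  | cons i v ih => simp [wordHopping_cons, ih, wordProd_cons, mul_assoc]

theorem norm_wordHopping_le {D : G → Ω → ℂ} {M : ℝ} (hM : ∀ σ z, ‖D σ z‖ ≤ M)
    (w : List (OffDiag G)) (z : Ω) : ‖wordHopping D w z‖ ≤ M ^ w.length := by
  rw [wordHopping, norm_prod]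
  calc _ ≤ ∏ _k : Fin w.length, M :=
        Finset.prod_le_prod (fun _ _ => norm_nonneg _) fun _ _ => hM _ _
    _ = _ := by simp

/-- The product of `s - E_k` over the energies `E_k` of the states of the path of `w` from `z`. -/
noncomputable def wordDenom (D : G → Ω → ℂ) (s : ℂ) (w : List (OffDiag G)) (z : Ω) : ℂ :=
  ∏ k ∈ Finset.range (w.length + 1), (s - D 1 (wordState w z k))

theorem wordDenom_nil (D : G → Ω → ℂ) (s : ℂ) (z : Ω) : wordDenom D s [] z = s - D 1 z := by
  simp [wordDenom, wordState_zero]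

theorem wordDenom_cons (D : G → Ω → ℂ) (s : ℂ) (i : OffDiag G) (w : List (OffDiag G)) (z : Ω) :
    wordDenom D s (i :: w) z = (s - D 1 z) * wordDenom D s w ((i.1 : Equiv.Perm Ω) z) := by
  simp only [wordDenom]
  rw [List.length_cons, Finset.prod_range_succ' _ (w.length + 1), mul_comm]
  simp only [wordState_cons_succ, wordState_zero]

theorem norm_wordDenom_ge {D : G → Ω → ℂ} {s : ℂ} {δ : ℝ} (hδ : 0 ≤ δ)
    (h : ∀ z, δ ≤ ‖s - D 1 z‖) (w : List (OffDiag G)) (z : Ω) :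
    δ ^ (w.length + 1) ≤ ‖wordDenom D s w z‖ := by
  rw [wordDenom, norm_prod]
  calc δ ^ (w.length + 1) = ∏ _k ∈ Finset.range (w.length + 1), δ := by simp
    _ ≤ _ := Finset.prod_le_prod (fun _ _ => hδ) fun _ _ => h _

variable [DecidableEq Ω]

/-! ### The resolvent as a sum over words -/

/-- The contribution of the path of `w` from `x` to the resolvent matrix element `(y, x)`. -/
noncomputable def resolventTerm (D : G → Ω → ℂ) (s : ℂ) (y x : Ω) (w : List (OffDiag G)) : ℂ :=
  if (wordProd w : Equiv.Perm Ω) x = y then wordHopping D w x / wordDenom D s w x else 0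

theorem norm_resolventTerm_le {D : G → Ω → ℂ} {M : ℝ} (hM0 : 0 ≤ M) (hM : ∀ σ z, ‖D σ z‖ ≤ M)
    {s : ℂ} {δ : ℝ} (hδ : 0 < δ) (h : ∀ z, δ ≤ ‖s - D 1 z‖) (y x : Ω) (w : List (OffDiag G)) :
    ‖resolventTerm D s y x w‖ ≤ δ⁻¹ * (M / δ) ^ w.length := by
  rw [resolventTerm]
  split_ifs
  · rw [norm_div]
    calc _ ≤ M ^ w.length / δ ^ (w.length + 1) :=
          div_le_div₀ (by positivity) (norm_wordHopping_le hM w x) (by positivity)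
            (norm_wordDenom_ge hδ.le h w x)
      _ = _ := by rw [div_pow, pow_succ]; field_simp
  · rw [norm_zero]; positivity

variable [Fintype Ω]

theorem mul_diagonal_mul_permMat_apply (S : Matrix Ω Ω ℂ) (d : Ω → ℂ) (σ : Equiv.Perm Ω)
    (y x : Ω) : (S * (Matrix.diagonal d * permMat σ)) y x = S y (σ x) * d (σ x) := by
  rw [← Matrix.mul_assoc, Matrix.mul_apply]
  simp [permMat_apply]

/-- Splitting off the first letter of a word shows that the sum over words is a left inverse of
`s - H`. -/
theorem resolvent_mul [Fintype G] {D : G → Ω → ℂ} {s : ℂ} (hs : ∀ z, s - D 1 z ≠ 0)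
    {S : Matrix Ω Ω ℂ} (hS : ∀ y x, HasSum (resolventTerm D s y x) (S y x)) :
    S * (s • (1 : Matrix Ω Ω ℂ) - pmrMatrix G D) = 1 := by
  classical
  ext y x
  -- The empty word and the first letters: the equation `S (s - D₁) = 1 + S (H - D₁)`, column by
  -- column.
  have hrec : HasSum (resolventTerm D s y x) (resolventTerm D s y x [] +
      ∑ i : OffDiag G, D i.1 ((i.1 : Equiv.Perm Ω) x) / (s - D 1 x) *
        S y ((i.1 : Equiv.Perm Ω) x)) := by
    refine hasSum_list_of_cons (hasSum_prod_of_fintype fun i => ?_)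
    refine ((hS y ((i.1 : Equiv.Perm Ω) x)).mul_left _).congr_fun fun w => ?_
    simp only [resolventTerm, wordProd_cons, wordHopping_cons, wordDenom_cons,
      Subgroup.coe_mul, Equiv.Perm.mul_apply]
    split_ifs
    · rw [div_mul_div_comm]
    · simp
  have hSeq := (hS y x).unique hrec
  have h0 : resolventTerm D s y x [] = (1 : Matrix Ω Ω ℂ) y x / (s - D 1 x) := by
    simp [resolventTerm, wordProd_nil, wordHopping_nil, wordDenom_nil, Matrix.one_apply, eq_comm,
      ite_div]
  have hSeq2 : S y x * (s - D 1 x) = (1 : Matrix Ω Ω ℂ) y x +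
      ∑ i : OffDiag G, S y ((i.1 : Equiv.Perm Ω) x) * D i.1 ((i.1 : Equiv.Perm Ω) x) := by
    rw [hSeq, h0, add_mul, div_mul_cancel₀ _ (hs x), Finset.sum_mul]
    congr 1
    refine Finset.sum_congr rfl fun i _ => ?_
    have := hs x
    field_simp
  rw [Matrix.mul_sub, Matrix.sub_apply, Matrix.mul_smul, Matrix.mul_one, Matrix.smul_apply,
    pmrMatrix, Matrix.mul_sum, Matrix.sum_apply]
  simp only [mul_diagonal_mul_permMat_apply]
  rw [Fintype.sum_eq_add_sum_subtype_ne _ (1 : G)]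
  simp only [Subgroup.coe_one, Equiv.Perm.one_apply, smul_eq_mul]
  linear_combination hSeq2

/-! ### Entire functions of a matrix -/

theorem exists_norm_pow_apply_le (H : Matrix Ω Ω ℂ) :
    ∃ C : ℝ, 0 ≤ C ∧ ∀ n y x, ‖(H ^ n) y x‖ ≤ C ^ n := by
  refine ⟨∑ x, ∑ z, ‖H z x‖, by positivity, fun n => ?_⟩
  induction n with
  | zero =>
    intro y x
    rw [pow_zero, Matrix.one_apply]
    split_ifs <;> simp
  | succ n ih =>
    intro y x
    rw [pow_succ, Matrix.mul_apply]
    calc _ ≤ ∑ z, (∑ x, ∑ z, ‖H z x‖) ^ n * ‖H z x‖ := by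
          refine (norm_sum_le _ _).trans (Finset.sum_le_sum fun z _ => ?_)
          rw [norm_mul]
          exact mul_le_mul_of_nonneg_right (ih y z) (norm_nonneg _)
      _ ≤ _ := by
          rw [← Finset.mul_sum, pow_succ]
          refine mul_le_mul_of_nonneg_left ?_ (by positivity)
          exact Finset.single_le_sum (f := fun x => ∑ z, ‖H z x‖)
            (fun _ _ => by positivity) (Finset.mem_univ x)

/-- The Laurent series of the resolvent at infinity is a left inverse of `s - H`. -/
theorem laurent_mul {H : Matrix Ω Ω ℂ} {s : ℂ} (hs : s ≠ 0) {T : Matrix Ω Ω ℂ}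
    (hT : ∀ y x, HasSum (fun n : ℕ => (H ^ n) y x / s ^ (n + 1)) (T y x)) :
    T * (s • (1 : Matrix Ω Ω ℂ) - H) = 1 := by
  ext y x
  have h1 : HasSum (fun n : ℕ => (H ^ n) y x / s ^ n) (T y x * s) := by
    refine ((hT y x).mul_right s).congr_fun fun n => ?_
    rw [pow_succ]
    field_simp
  have h2 : HasSum (fun n : ℕ => (H ^ (n + 1)) y x / s ^ (n + 1)) (∑ z, T y z * H z x) := by
    refine (hasSum_sum fun z (_ : z ∈ Finset.univ) => (hT y z).mul_right (H z x)).congr_fun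
      fun n => ?_
    rw [pow_succ, Matrix.mul_apply, Finset.sum_div]
    exact Finset.sum_congr rfl fun z _ => by rw [div_mul_eq_mul_div]
  have h3 := ((hasSum_nat_add_iff (f := fun n : ℕ => (H ^ n) y x / s ^ n) 1).1 h2).unique h1
  rw [Matrix.mul_sub, Matrix.sub_apply, Matrix.mul_smul, Matrix.mul_one, Matrix.smul_apply,
    Matrix.mul_apply, smul_eq_mul]
  simp only [Finset.range_one, Finset.sum_singleton, pow_zero, div_one] at h3
  linear_combination -h3

/-- The path expansion of the matrix elements of `f(H)`. Both sides equal
`(2πi)⁻¹ ∮ f(s) (s - H)⁻¹ ds` over a large circle, with the resolvent expanded in powers of `H` for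
the Taylor series and over words for the path sum. -/
theorem exists_hasSum_taylorTerm_and_words [Fintype G] (D : G → Ω → ℂ) {f : ℂ → ℂ}
    (hf : Differentiable ℂ f) :
    ∃ F : Matrix Ω Ω ℂ, HasSum (taylorTerm f (pmrMatrix G D)) F ∧
      ∀ y x, HasSum (fun w : List (OffDiag G) => if (wordProd w : Equiv.Perm Ω) x = y then
        wordHopping D w x * divDiff f (fun k => D 1 (wordState w x k)) w.length else 0)
        (F y x) := by
  classical
  set H := pmrMatrix G D
  obtain ⟨C, hC0, hC⟩ := exists_norm_pow_apply_le H
  set M : ℝ := ∑ σ, ∑ z, ‖D σ z‖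
  have hM0 : 0 ≤ M := by positivity
  have hM : ∀ σ z, ‖D σ z‖ ≤ M := fun σ z =>
    (Finset.single_le_sum (f := fun z => ‖D σ z‖) (fun _ _ => norm_nonneg _)
      (Finset.mem_univ z)).trans
    (Finset.single_le_sum (f := fun σ => ∑ z, ‖D σ z‖) (fun _ _ => by positivity)
      (Finset.mem_univ σ))
  -- On the circle of radius `R` all energies are at distance at least `δ` from `s`, and `δ` is
  -- large enough for the geometric series over words to converge.
  set δ : ℝ := 1 + C + Fintype.card (OffDiag G) * M with hδdef
  have hδ1 : 1 ≤ δ := by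
    have : 0 ≤ Fintype.card (OffDiag G) * M := by positivity
    linarith
  have hδ0 : 0 < δ := by linarith
  set R : ℝ := M + δ with hRdef
  have hR0 : 0 < R := by linarith
  have hCR : C < R := by
    have : 0 ≤ Fintype.card (OffDiag G) * M := by positivity
    linarith
  have hsd : ∀ s ∈ Metric.sphere (0 : ℂ) R, ∀ z, δ ≤ ‖s - D 1 z‖ := by
    intro s hs z
    rw [mem_sphere_zero_iff_norm] at hs
    have h1 := norm_sub_norm_le s (D 1 z)
    have h2 := hM 1 z
    linarith
  have hs0 : ∀ s ∈ Metric.sphere (0 : ℂ) R, s ≠ 0 := by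
    rintro s hs rfl
    rw [mem_sphere_zero_iff_norm, norm_zero] at hs
    linarith
  have hgeom : Summable fun w : List (OffDiag G) => (M / δ) ^ w.length := by
    refine summable_pow_length (by positivity) ?_
    rw [← mul_div_assoc, div_lt_one hδ0]
    linarith
  have hratio : Summable fun n : ℕ => R⁻¹ * (C / R) ^ n :=
    (summable_geometric_of_lt_one (by positivity) ((div_lt_one hR0).2 hCR)).mul_left _
  have hlaur : ∀ s ∈ Metric.sphere (0 : ℂ) R, ∀ y x n,
      ‖(H ^ n) y x / s ^ (n + 1)‖ ≤ R⁻¹ * (C / R) ^ n := by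
    intro s hs y x n
    rw [mem_sphere_zero_iff_norm] at hs
    rw [norm_div, norm_pow, hs]
    calc _ ≤ C ^ n / R ^ (n + 1) := by gcongr; exact hC n y x
      _ = _ := by rw [div_pow, pow_succ]; field_simp
  have hres : ∀ s ∈ Metric.sphere (0 : ℂ) R, ∀ y x w,
      ‖resolventTerm D s y x w‖ ≤ δ⁻¹ * (M / δ) ^ w.length := fun s hs y x w =>
    norm_resolventTerm_le hM0 hM hδ0 (hsd s hs) y x w
  set S : ℂ → Matrix Ω Ω ℂ := fun s => Matrix.of fun y x => ∑' w, resolventTerm D s y x w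
  have hS : ∀ s ∈ Metric.sphere (0 : ℂ) R, ∀ y x,
      HasSum (resolventTerm D s y x) (S s y x) := fun s hs y x =>
    (Summable.of_norm_bounded (hgeom.mul_left _) (hres s hs y x)).hasSum
  have hT : ∀ s ∈ Metric.sphere (0 : ℂ) R, ∀ y x,
      HasSum (fun n : ℕ => (H ^ n) y x / s ^ (n + 1)) (S s y x) := by
    intro s hs
    set T : Matrix Ω Ω ℂ := Matrix.of fun y x => ∑' n : ℕ, (H ^ n) y x / s ^ (n + 1)
    have hT : ∀ y x, HasSum (fun n : ℕ => (H ^ n) y x / s ^ (n + 1)) (T y x) := fun y x =>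
      (Summable.of_norm_bounded hratio (hlaur s hs y x)).hasSum
    have h1 := resolvent_mul (fun z => norm_pos_iff.1 (hδ0.trans_le (hsd s hs z))) (hS s hs)
    -- Both expansions are left inverses of the same matrix, hence equal.
    have h2 := mul_eq_one_comm.1 (laurent_mul (hs0 s hs) hT)
    have hST : S s = T := by
      rw [← Matrix.mul_one (S s), ← h2, ← Matrix.mul_assoc, h1, Matrix.one_mul]
    rw [hST]
    exact hT
  obtain ⟨N, hN⟩ := (isCompact_sphere (0 : ℂ) R).exists_bound_of_continuousOn
    hf.continuous.continuousOn
  have hN0 : 0 ≤ N := (norm_nonneg _).trans (hN (R : ℂ) (by simp [abs_of_pos hR0]))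
  refine ⟨Matrix.of fun y x => (2 * Real.pi * Complex.I)⁻¹ * ∮ s in C(0, R), f s * S s y x,
    Pi.hasSum.2 fun y => Pi.hasSum.2 fun x => ?_, fun y x => ?_⟩
  · have h := (hasSum_circleIntegral (c := 0) hR0.le
      (F := fun (n : ℕ) s => f s * ((H ^ n) y x / s ^ (n + 1))) (g := fun s => f s * S s y x)
      (hratio.mul_left N)
      (fun n => hf.continuous.continuousOn.mul (continuousOn_const.div (by fun_prop)
        fun s hs => pow_ne_zero _ (hs0 s hs)))
      (fun n s hs => by
        rw [norm_mul]
        exact mul_le_mul (hN s hs) (hlaur s hs y x n) (norm_nonneg _) hN0)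
      (fun s hs => (hT s hs y x).mul_left _)).mul_left (2 * Real.pi * Complex.I)⁻¹
    refine h.congr_fun fun n => ?_
    have hcauchy := hf.differentiableOn.circleIntegral_one_div_sub_center_pow_smul
      (c := 0) hR0 n
    have hfun : (fun s : ℂ => f s * ((H ^ n) y x / s ^ (n + 1))) =
        fun s => (H ^ n) y x * ((1 / (s - 0) ^ (n + 1)) • f s) := by
      funext s
      rw [sub_zero, smul_eq_mul]
      ring
    rw [hfun, circleIntegral.integral_const_mul, hcauchy, taylorTerm, Matrix.smul_apply]
    have := Complex.two_pi_I_ne_zero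
    simp only [smul_eq_mul]
    field_simp
  · have h := (hasSum_circleIntegral (c := 0) hR0.le
      (F := fun w s => f s * resolventTerm D s y x w) (g := fun s => f s * S s y x)
      ((hgeom.mul_left δ⁻¹).mul_left N) (fun w => ?_)
      (fun w s hs => by
        rw [norm_mul]
        exact mul_le_mul (hN s hs) (hres s hs y x w) (norm_nonneg _) hN0)
      (fun s hs => (hS s hs y x).mul_left _)).mul_left (2 * Real.pi * Complex.I)⁻¹
    · refine h.congr_fun fun w => ?_
      simp only [resolventTerm]
      split_ifs
      · rw [divDiff_eq hf (R := R) fun i _ => (hM 1 _).trans_lt (by linarith)]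
        have hfun : (fun s : ℂ => f s * (wordHopping D w x / wordDenom D s w x)) =
            fun s => wordHopping D w x * (f s / wordDenom D s w x) := by
          funext s
          ring
        rw [hfun, circleIntegral.integral_const_mul]
        simp only [wordDenom]
        ring
      · simp [circleIntegral]
    · refine hf.continuous.continuousOn.mul ?_
      simp only [resolventTerm]
      split_ifs
      · refine continuousOn_const.div (by unfold wordDenom; fun_prop) fun s hs => ?_
        exact norm_pos_iff.1
          ((pow_pos hδ0 _).trans_le (norm_wordDenom_ge hδ0.le (hsd s hs) w x))
      · exact continuousOn_const

end Words

/-! ### Canonical products -/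

section Canonical

variable {Ω : Type*} {G : Subgroup (Equiv.Perm Ω)}

/-- The word `[l_L, …, l_1]` of the permutations of a canonical product, in the order in which they
act. -/
def canonicalWord {L : ℕ} (l : Fin L → OffDiag G) : List (OffDiag G) := (List.ofFn l).reverse

theorem length_canonicalWord {L : ℕ} (l : Fin L → OffDiag G) : (canonicalWord l).length = L := by
  simp [canonicalWord]

theorem canonicalWord_succ {L : ℕ} (l : Fin (L + 1) → OffDiag G) :
    canonicalWord l = canonicalWord (fun s => l s.succ) ++ [l 0] := by
  simp [canonicalWord, List.ofFn_succ]

theorem getElem?_canonicalWord {L : ℕ} (l : Fin L → OffDiag G) (s : Fin L) :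
    (canonicalWord l)[L - s - 1]? = some (l s) := by
  have hs := s.2
  rw [canonicalWord, List.getElem?_reverse (by simp; omega)]
  have : (List.ofFn l).length - 1 - (L - s - 1) = s := by simp; omega
  rw [this]
  simp

variable [Fintype Ω] [DecidableEq Ω]

theorem diagonal_mul_permMat_mul_apply (a b : Ω → ℂ) (σ : Equiv.Perm Ω)
    (B : Matrix Ω Ω ℂ) (z y : Ω) :
    (Matrix.diagonal a * Matrix.diagonal b * permMat σ * B) z y =
      a z * b z * B (σ.symm z) y := by
  rw [Matrix.mul_apply, Finset.sum_eq_single (σ.symm z)]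
  · simp [Matrix.diagonal_mul_diagonal, permMat_apply]
  · intro x _ hx
    have : z ≠ σ x := fun h => hx (by rw [h, Equiv.symm_apply_apply])
    simp [Matrix.diagonal_mul_diagonal, permMat_apply, this]
  · simp

theorem canonicalProduct_succ (D : G → Ω → ℂ) {L : ℕ} (Λ : Fin (L + 2) → Ω → ℂ)
    (l : Fin (L + 1) → OffDiag G) :
    canonicalProduct D Λ l = Matrix.diagonal (Λ 0) * Matrix.diagonal (D (l 0).1) *
      permMat ((l 0).1 : Equiv.Perm Ω) *
        canonicalProduct D (fun s => Λ s.succ) (fun s => l s.succ) := by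
  rw [canonicalProduct, canonicalProduct, List.ofFn_succ, List.prod_cons, Matrix.mul_assoc]
  rfl

/-- A canonical product sends the basis state `y` to a multiple of the end point of the path of
its word from `y`. -/
theorem canonicalProduct_apply (D : G → Ω → ℂ) {L : ℕ} (Λ : Fin (L + 1) → Ω → ℂ)
    (l : Fin L → OffDiag G) (z y : Ω) :
    canonicalProduct D Λ l z y =
      if (wordProd (canonicalWord l) : Equiv.Perm Ω) y = z then
        wordHopping D (canonicalWord l) y * (Λ (Fin.last L) y *
          ∏ s : Fin L, Λ s.castSucc (wordState (canonicalWord l) y (L - s))) else 0 := by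
  induction L generalizing z with
  | zero =>
    simp only [canonicalProduct, canonicalWord, List.ofFn_zero, List.prod_nil, one_mul,
      List.reverse_nil, wordProd_nil, wordHopping_nil, Finset.univ_eq_empty, Finset.prod_empty,
      mul_one, Subgroup.coe_one, Equiv.Perm.one_apply, Matrix.diagonal_apply, eq_comm (a := y)]
    split_ifs with h
    · rw [h]
    · rfl
  | succ L ih =>
    rw [canonicalProduct_succ, diagonal_mul_permMat_mul_apply, ih]
    set v := canonicalWord fun s => l s.succ
    have hvlen : v.length = L := length_canonicalWord _
    have hw : canonicalWord l = v ++ [l 0] := canonicalWord_succ l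
    have hend : (wordProd (canonicalWord l) : Equiv.Perm Ω) y =
        ((l 0).1 : Equiv.Perm Ω) ((wordProd v : Equiv.Perm Ω) y) := by
      rw [hw, wordProd_append, wordProd_cons, wordProd_nil, one_mul]
      rfl
    have hiff : (wordProd (canonicalWord l) : Equiv.Perm Ω) y = z ↔
        (wordProd v : Equiv.Perm Ω) y = ((l 0).1 : Equiv.Perm Ω).symm z := by
      rw [hend, Equiv.eq_symm_apply]
    simp only [hiff]
    split_ifs with h
    · have hz : ((l 0).1 : Equiv.Perm Ω) ((wordProd v : Equiv.Perm Ω) y) = z := by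
        rw [h, Equiv.apply_symm_apply]
      rw [Fin.prod_univ_succ]
      have h0 : wordState (canonicalWord l) y (L + 1 - (0 : Fin (L + 1))) = z := by
        rw [← hz, ← hend, ← wordState_length, length_canonicalWord]
        rfl
      have hs : ∀ s : Fin L, wordState (canonicalWord l) y (L + 1 - s.succ) =
          wordState v y (L - s) := fun s => by
        rw [hw, Fin.val_succ, Nat.add_sub_add_right, wordState_append_of_le _ _ _ (by omega)]
      rw [h0, hw, wordHopping_append, wordHopping_cons, wordHopping_nil, hz]
      simp only [← hw, hs, Fin.castSucc_zero, ← Fin.succ_castSucc, Fin.succ_last]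
      ring
    · rw [mul_zero]

end Canonical

/-! ### Traces as sums over configurations -/

theorem divDiff_congr (f : ℂ → ℂ) {x y : ℕ → ℂ} {q : ℕ} (h : ∀ i ≤ q, x i = y i) :
    divDiff f x q = divDiff f y q := by
  have h1 : ∀ i ∈ Finset.range (q + 1), x i = y i := fun i hi =>
    h i (Nat.lt_succ_iff.1 (Finset.mem_range.1 hi))
  have h2 : ∑ i ∈ Finset.range (q + 1), ‖x i‖ = ∑ i ∈ Finset.range (q + 1), ‖y i‖ :=
    Finset.sum_congr rfl fun i hi => by rw [h1 i hi]
  have h3 : ∀ w : ℂ, ∏ i ∈ Finset.range (q + 1), (w - x i) =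
      ∏ i ∈ Finset.range (q + 1), (w - y i) := fun w =>
    Finset.prod_congr rfl fun i hi => by rw [h1 i hi]
  simp only [divDiff, h2, h3]

variable {Ω : Type*} {G : Subgroup (Equiv.Perm Ω)}

theorem Config.hopping_eq (D : G → Ω → ℂ) (C : Config G) :
    C.hopping D = wordHopping D C.word C.z := rfl

theorem Config.state_eq (C : Config G) (k : ℕ) : C.state k = wordState C.word C.z k := rfl

theorem Config.eq_of_z_of_word {C C' : Config G} (hz : C.z = C'.z) (hw : C.word = C'.word) : C = C' := by
  cases C; cases C'; simp_all

variable [Fintype Ω] [DecidableEq Ω]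

/-- The prefactor selects the configurations whose word ends with the canonical word. -/
theorem canonicalPrefactor_of_append {L : ℕ} (Λ : Fin (L + 1) → Ω → ℂ) (l : Fin L → OffDiag G)
    {C : Config G} {w : List (OffDiag G)} (hw : C.word = w ++ canonicalWord l) :
    canonicalPrefactor Λ l C = Λ (Fin.last L) ((wordProd w : Equiv.Perm Ω) C.z) *
      ∏ s : Fin L, Λ s.castSucc
        (wordState (canonicalWord l) ((wordProd w : Equiv.Perm Ω) C.z) (L - s)) := by
  have hq : C.q = w.length + L := by
    rw [Config.q, hw, List.length_append, length_canonicalWord]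
  rw [canonicalPrefactor]
  congr 1
  · rw [hq, Nat.add_sub_cancel, C.state_eq, hw, wordState_append_of_le _ _ _ le_rfl,
      wordState_length]
  · refine Finset.prod_congr rfl fun s _ => ?_
    have hs := s.2
    have hd : C.delta (C.q - s) (l s) = 1 := by
      rw [Config.delta, if_pos]
      rw [hw, hq, show w.length + L - s - 1 = w.length + (L - s - 1) by omega,
        List.getElem?_append_right (Nat.le_add_right _ _), Nat.add_sub_cancel_left,
        getElem?_canonicalWord]
    rw [hd, mul_one, C.state_eq, hw, hq, Nat.add_sub_assoc hs.le, wordState_append_length_add]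

theorem exists_append_of_canonicalPrefactor_ne_zero {L : ℕ} {Λ : Fin (L + 1) → Ω → ℂ}
    {l : Fin L → OffDiag G} {C : Config G} (hL : L ≤ C.q) (h : canonicalPrefactor Λ l C ≠ 0) :
    ∃ w, C.word = w ++ canonicalWord l := by
  have hd : ∀ s : Fin L, C.word[C.q - s - 1]? = some (l s) := fun s => by
    have h1 := Finset.prod_ne_zero_iff.1 (right_ne_zero_of_mul h) s (Finset.mem_univ s)
    have h2 := right_ne_zero_of_mul h1
    rw [Config.delta] at h2
    by_contra h3
    exact h2 (if_neg h3)
  refine ⟨C.word.take (C.q - L), ?_⟩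
  have hdrop : C.word.drop (C.q - L) = canonicalWord l := by
    refine List.ext_getElem? fun i => ?_
    rcases lt_or_ge i L with hi | hi
    · have h1 := hd ⟨L - 1 - i, by omega⟩
      have h2 := getElem?_canonicalWord l ⟨L - 1 - i, by omega⟩
      simp only at h1 h2
      rw [show L - (L - 1 - i) - 1 = i by omega] at h2
      rw [show C.q - (L - 1 - i) - 1 = C.q - L + i by omega] at h1
      rw [List.getElem?_drop, h1, h2]
    · rw [List.getElem?_eq_none, List.getElem?_eq_none]
      · rwa [length_canonicalWord]
      · rw [List.length_drop]
        change C.q - (C.q - L) ≤ i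
        omega
  rw [← hdrop, List.take_append_drop]

/-- The expansion of `Tr[A F]` for a canonical product `A` and a matrix `F` with a path expansion:
appending the word of `A` to a path contributing to `F` closes it up to a configuration. -/
theorem hasSum_config_trace (hG : IsRegularGroup G) (D : G → Ω → ℂ) (f : ℂ → ℂ)
    {F : Matrix Ω Ω ℂ}
    (hF : ∀ y x, HasSum (fun w : List (OffDiag G) => if (wordProd w : Equiv.Perm Ω) x = y then
        wordHopping D w x * divDiff f (fun k => D 1 (wordState w x k)) w.length else 0) (F y x))
    {L : ℕ} (Λ : Fin (L + 1) → Ω → ℂ) (l : Fin L → OffDiag G) :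
    HasSum (fun C : Config G => if L ≤ C.q then
        C.hopping D * (canonicalPrefactor Λ l C * divDiff f (C.energy D) (C.q - L)) else 0)
      (canonicalProduct D Λ l * F).trace := by
  set r := canonicalWord l with hr
  set e : Equiv.Perm Ω := (wordProd r : Equiv.Perm Ω) with he
  set a : Ω → ℂ := fun y => wordHopping D r y * (Λ (Fin.last L) y *
    ∏ s : Fin L, Λ s.castSucc (wordState r y (L - s))) with ha
  have htr : (canonicalProduct D Λ l * F).trace = ∑ z, a (e.symm z) * F (e.symm z) z := by
    rw [Matrix.trace]
    refine Finset.sum_congr rfl fun z _ => ?_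
    rw [Matrix.diag_apply, Matrix.mul_apply, Finset.sum_eq_single (e.symm z)]
    · rw [canonicalProduct_apply, if_pos (e.apply_symm_apply z)]
    · intro y _ hy
      rw [canonicalProduct_apply, if_neg, zero_mul]
      intro h
      exact hy (by rw [← h, e.symm_apply_apply])
    · simp
  rw [htr]
  -- The closed extended paths, as pairs of a starting state and a word.
  set T : Set (Ω × List (OffDiag G)) := {p | (wordProd (p.2 ++ r) : Equiv.Perm Ω) p.1 = p.1}
  have hmem : ∀ p : Ω × List (OffDiag G),
      p ∈ T ↔ (wordProd p.2 : Equiv.Perm Ω) p.1 = e.symm p.1 := fun p => by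
    rw [Equiv.eq_symm_apply, he]
    change (wordProd (p.2 ++ r) : Equiv.Perm Ω) p.1 = p.1 ↔ _
    rw [wordProd_append]
    rfl
  have hsum := hasSum_prod_of_fintype (f := fun p : Ω × List (OffDiag G) => a (e.symm p.1) *
    if (wordProd p.2 : Equiv.Perm Ω) p.1 = e.symm p.1 then wordHopping D p.2 p.1 *
      divDiff f (fun k => D 1 (wordState p.2 p.1 k)) p.2.length else 0)
    (fun z => (hF (e.symm z) z).mul_left (a (e.symm z)))
  rw [← (Subtype.val_injective (p := (· ∈ T))).hasSum_iff] at hsum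
  swap
  · intro p hp
    rw [if_neg, mul_zero]
    rw [← hmem]
    simpa using hp
  let φ : T → Config G := fun p => ⟨p.1.1, p.1.2 ++ r, Subtype.ext
    (hG.2 _ (wordProd (p.1.2 ++ r)).2 p.1.1 p.2)⟩
  have hφ : Function.Injective φ := by
    rintro ⟨⟨z, w⟩, hp⟩ ⟨⟨z', w'⟩, hp'⟩ h
    have h1 : z = z' := congrArg Config.z h
    have h2 : w ++ r = w' ++ r := congrArg Config.word h
    rw [List.append_cancel_right_eq] at h2
    subst h1 h2
    rfl
  refine (hφ.hasSum_iff ?_).1 (hsum.congr_fun ?_)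
  · intro C hC
    split_ifs with hL
    · by_contra hne
      obtain ⟨w, hw⟩ := exists_append_of_canonicalPrefactor_ne_zero hL
        (left_ne_zero_of_mul (right_ne_zero_of_mul hne))
      refine hC ⟨⟨(C.z, w), ?_⟩, Config.eq_of_z_of_word rfl hw.symm⟩
      change (wordProd (w ++ r) : Equiv.Perm Ω) C.z = C.z
      rw [hr, ← hw, C.closed]
      rfl
    · rfl
  · rintro ⟨⟨z, w⟩, hp⟩
    have hw := (hmem _).1 hp
    simp only at hw
    set C : Config G := φ ⟨(z, w), hp⟩
    have hword : C.word = w ++ r := rfl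
    have hq : C.q = w.length + L := by
      rw [Config.q, hword, List.length_append, hr, length_canonicalWord]
    have hdd : divDiff f (C.energy D) w.length =
        divDiff f (fun k => D 1 (wordState w z k)) w.length :=
      divDiff_congr f fun i hi => by
        rw [Config.energy, C.state_eq, hword, wordState_append_of_le _ _ _ hi]
    change (if L ≤ C.q then C.hopping D * (canonicalPrefactor Λ l C *
      divDiff f (C.energy D) (C.q - L)) else 0) = a (e.symm z) * if _ then _ else _
    rw [if_pos (by omega), if_pos hw, hq, Nat.add_sub_cancel, hdd,
      canonicalPrefactor_of_append Λ l hword, C.hopping_eq, hword, wordHopping_append, ha]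
    change wordHopping D w z * wordHopping D r ((wordProd w : Equiv.Perm Ω) z) *
      (Λ (Fin.last L) ((wordProd w : Equiv.Perm Ω) z) * (∏ s : Fin L, Λ s.castSucc
        (wordState r ((wordProd w : Equiv.Perm Ω) z) (L - s))) * _) = _
    rw [hw]
    ring

/-- The expansion of `Tr F`: the identity is the canonical product without permutations. -/
theorem hasSum_config_trace_one (hG : IsRegularGroup G) (D : G → Ω → ℂ) (f : ℂ → ℂ)
    {F : Matrix Ω Ω ℂ}
    (hF : ∀ y x, HasSum (fun w : List (OffDiag G) => if (wordProd w : Equiv.Perm Ω) x = y then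
        wordHopping D w x * divDiff f (fun k => D 1 (wordState w x k)) w.length else 0) (F y x)) :
    HasSum (fun C : Config G => C.hopping D * divDiff f (C.energy D) C.q) F.trace := by
  have h := hasSum_config_trace hG D f hF (L := 0) (fun _ _ => 1) Fin.elim0
  simpa [canonicalPrefactor, canonicalProduct] using h

/-! ### The thermal state -/

variable [Fintype G]

theorem pmrMatrix_apply_self (hG : IsRegularGroup G) (D : G → Ω → ℂ) (z : Ω) :
    pmrMatrix G D z z = D 1 z := by
  rw [pmrMatrix, Matrix.sum_apply, Finset.sum_eq_single 1]
  · simp [permMat_apply]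
  · intro σ _ hσ
    have : z ≠ (σ : Equiv.Perm Ω) z := fun h => hσ (Subtype.ext (hG.2 _ σ.2 z h.symm))
    simp [permMat_apply, this]
  · simp

theorem dde_energy_ne_zero (hG : IsRegularGroup G) {D : G → Ω → ℂ}
    (hH : (pmrMatrix G D).IsHermitian) {t : ℝ} (ht : t ≠ 0) (C : Config G) (q : ℕ) :
    dde t (C.energy D) q ≠ 0 := by
  -- The energies are diagonal elements of a Hermitian matrix.
  have hre : ∀ z, ((D 1 z).re : ℂ) = D 1 z := fun z => by
    rw [← pmrMatrix_apply_self hG D z]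
    exact Complex.conj_eq_iff_re.1 (hH.apply z z)
  have : Nonempty Ω := ⟨C.z⟩
  obtain ⟨z₀, hz₀⟩ := Finite.exists_min fun z => t * (D 1 z).re
  have h := dde_ne_zero (c := (D 1 z₀).re) ht (x := fun k => (C.energy D k).re)
    (fun k => by rw [mul_sub]; exact sub_nonneg.2 (hz₀ _)) q
  have hC : (fun k => ((C.energy D k).re : ℂ)) = C.energy D := funext fun k => hre _
  rwa [hC] at h

theorem gibbs_eq_of_hasSum_taylorTerm {H F : Matrix Ω Ω ℂ} {β : ℝ}
    (h : HasSum (taylorTerm (fun w => Complex.exp ((-β : ℝ) * w)) H) F) : gibbs H β = F := by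
  rw [gibbs, NormedSpace.exp_eq_tsum ℂ, ← h.tsum_eq]
  refine tsum_congr fun n => ?_
  rw [taylorTerm, iteratedDeriv_cexp_const_mul, smul_pow, smul_smul]
  simp [div_eq_inv_mul]

open scoped ComplexOrder in
theorem trace_gibbs_ne_zero [Nonempty Ω] {H : Matrix Ω Ω ℂ} (hH : H.IsHermitian) (β : ℝ) :
    (gibbs H β).trace ≠ 0 := by
  set X : Matrix Ω Ω ℂ := ((-(β / 2) : ℝ) : ℂ) • H with hX
  have hXX : (-(β : ℂ)) • H = X + X := by
    rw [hX, ← add_smul]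
    congr 1
    push_cast
    ring
  have hXH : X.conjTranspose = X := by
    rw [hX, Matrix.conjTranspose_smul, hH.eq]
    simp
  have hexp : gibbs H β = (NormedSpace.exp X).conjTranspose * NormedSpace.exp X := by
    rw [gibbs, hXX, Matrix.exp_add_of_commute _ _ (Commute.refl X), ← Matrix.exp_conjTranspose,
      hXH]
  rw [hexp]
  intro h
  exact (Matrix.isUnit_exp X).ne_zero (Matrix.trace_conjTranspose_mul_self_eq_zero_iff.1 h)

theorem isUnbiasedEstimator_canonicalEstimator [Nonempty Ω] (hG : IsRegularGroup G)
    {D : G → Ω → ℂ} (hH : (pmrMatrix G D).IsHermitian) {β : ℝ} (hβ : β ≠ 0) {L : ℕ}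
    (Λ : Fin (L + 1) → Ω → ℂ) (l : Fin L → OffDiag G) :
    IsUnbiasedEstimator G D β (canonicalProduct D Λ l) (canonicalEstimator D β Λ l) := by
  obtain ⟨F, hF, hFw⟩ := exists_hasSum_taylorTerm_and_words D
    (f := fun w => Complex.exp ((-β : ℝ) * w)) (by fun_prop)
  have hgibbs := gibbs_eq_of_hasSum_taylorTerm hF
  have htr := trace_gibbs_ne_zero hH β
  have hw : HasSum (weight D β) (gibbs (pmrMatrix G D) β).trace := by
    rw [hgibbs]
    exact hasSum_config_trace_one hG D _ hFw
  have hest : HasSum (fun C : Config G => weight D β C * canonicalEstimator D β Λ l C)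
      (canonicalProduct D Λ l * gibbs (pmrMatrix G D) β).trace := by
    rw [hgibbs]
    refine (hasSum_config_trace hG D _ hFw Λ l).congr_fun fun C => ?_
    rw [weight, canonicalEstimator]
    split_ifs
    · have h0 := dde_energy_ne_zero hG hH (neg_ne_zero.2 hβ) C C.q
      change _ = C.hopping D * (canonicalPrefactor Λ l C * dde (-β) (C.energy D) (C.q - L))
      field_simp
    · rw [mul_zero]
  exact ⟨htr, hw.summable, by rwa [hw.tsum_eq], hest.summable, by rw [hest.tsum_eq, hw.tsum_eq]⟩

end PMR

theorem mainTheorem2 {Ω : Type*} [Fintype Ω] [DecidableEq Ω] [Nonempty Ω]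
    (G : Subgroup (Equiv.Perm Ω)) [Fintype G] (hG : PMR.IsRegularGroup G)
    (H : Matrix Ω Ω ℂ) (hHerm : H.IsHermitian)
    (D : G → Ω → ℂ) (hPMR : H = PMR.pmrMatrix G D)
    (β : ℝ) (hβ : β ≠ 0) :
    -- off-diagonal series expansion of `Tr f(H)`
    (∀ f : ℂ → ℂ, Differentiable ℂ f →
      Summable (PMR.taylorTerm f H) ∧
      HasSum (fun C : PMR.Config G => C.hopping D * PMR.divDiff f (C.energy D) C.q)
        (∑' n, PMR.taylorTerm f H n).trace) ∧
    -- the estimators never divide by zero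
    (∀ C : PMR.Config G, PMR.dde (-β) (C.energy D) C.q ≠ 0) ∧
    -- the canonical estimator is an unbiased estimator of the canonical product
    (∀ (L : ℕ) (Λ : Fin (L + 1) → Ω → ℂ) (l : Fin L → PMR.OffDiag G),
      PMR.IsUnbiasedEstimator G D β (PMR.canonicalProduct D Λ l)
        (PMR.canonicalEstimator D β Λ l)) := by
  subst hPMR
  refine ⟨fun f hf => ?_, fun C => PMR.dde_energy_ne_zero hG hHerm (neg_ne_zero.2 hβ) C C.q,
    fun L Λ l => PMR.isUnbiasedEstimator_canonicalEstimator hG hHerm hβ Λ l⟩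
  obtain ⟨F, hF, hFw⟩ := PMR.exists_hasSum_taylorTerm_and_words D hf
  exact ⟨hF.summable, hF.tsum_eq ▸ PMR.hasSum_config_trace_one hG D f hFw⟩
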